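/- Let $\Lambda$ be a (unital, associative, not necessarily commutative) ring and let $B\subseteq\Lambda$ be a subring such that $\Lambda$, considered as a right $B$-module, is a finitely generated projective generator. For left $B$-modules $M,N$ and $i\ge 0$, the exact induction functor $\Lambda\otimes_B-$ from left $B$-modules to left $\Lambda$-modules induces homomorphisms \[\operatorname{Ext}^i_B(M,N)\longrightarrow \operatorname{Ext}^i_\Lambda(\Lambda\otimes_B M,\Lambda\otimes_B N).\] Assume that, for all left $B$-modules $M$ and $N$, these homomorphisms are epimorphisms for $i\ge 1$ and isomorphisms for $i\ge 2$. Let $W=\operatorname{Hom}_{B^{\mathrm{op}}}(\Lambda,B)$ be the right dual coring of $\Lambda$, i.e. the set of right $B$-linear maps $\Lambda\to B$ with the $B$-$B$-bimodule structure $(bf)(x)=b\,f(x)$, $(fb)(x)=f(bx)$. Its counit is the bimodule homomorphism $\varepsilon\colon W\to B$, $f\mapsto f(1)$. Put $\overline W=\ker\varepsilon$, a sub-bimodule of $W$. Then $\overline W$ is left projectivising, that is, for every left $B$-module $X$ the left $B$-module $\overline W\otimes_B X$ is projective. -/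

import Mathlib

open CategoryTheory Limits MulOpposite
open scoped TensorProduct

universe u w

noncomputable section

namespace RingExt

/-! ### Tensor products over a noncommutative ring

For a right `B`-module `N` (a module over `Bᵐᵒᵖ`) and a left `B`-module `M`, the abelian group
`N ⊗_B M` is the quotient of `N ⊗_ℤ M` by the subgroup generated by the elements
`(n b) ⊗ m - n ⊗ (b m)`.  If `N` is an `R`-`B`-bimodule, it is a left `R`-module. -/

section Balanced

variable (R B : Type*) [Ring R] [Ring B]
variable (N : Type*) [AddCommGroup N] [Module R N] [Module Bᵐᵒᵖ N] [SMulCommClass R Bᵐᵒᵖ N]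
variable (M : Type w) [AddCommGroup M] [Module B M]

/-- The subgroup of `N ⊗_ℤ M` generated by the elements `(n b) ⊗ m - n ⊗ (b m)`;
it is stable under the left action of `R`. -/
def balancedRel : Submodule R (N ⊗[ℤ] M) where
  __ := AddSubgroup.closure
    {t : N ⊗[ℤ] M | ∃ (n : N) (b : B) (m : M), t = (op b • n) ⊗ₜ[ℤ] m - n ⊗ₜ[ℤ] (b • m)}
  smul_mem' r x hx := by
    change r • x ∈ AddSubgroup.closure _
    replace hx : x ∈ AddSubgroup.closure
      {t : N ⊗[ℤ] M | ∃ (n : N) (b : B) (m : M),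
        t = (op b • n) ⊗ₜ[ℤ] m - n ⊗ₜ[ℤ] (b • m)} := hx
    induction hx using AddSubgroup.closure_induction with
    | mem t ht =>
      obtain ⟨n, b, m, rfl⟩ := ht
      refine AddSubgroup.subset_closure ⟨r • n, b, m, ?_⟩
      rw [smul_sub, TensorProduct.smul_tmul', TensorProduct.smul_tmul', smul_comm]
    | zero => simp
    | add x y _ _ hx hy => simpa [smul_add] using AddSubgroup.add_mem _ hx hy
    | neg x _ hx => simpa [smul_neg] using AddSubgroup.neg_mem _ hx

/-- The left `R`-module `N ⊗_B M` for an `R`-`B`-bimodule `N` and a left `B`-module `M`. -/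
abbrev BTensor : Type _ := (N ⊗[ℤ] M) ⧸ balancedRel R B N M

variable {N M}

/-- The class of `n ⊗ m` in `N ⊗_B M`. -/
def BTensor.tmul (n : N) (m : M) : BTensor R B N M :=
  (balancedRel R B N M).mkQ (n ⊗ₜ[ℤ] m)

variable {R B}

lemma BTensor.smul_tmul (r : R) (n : N) (m : M) :
    r • BTensor.tmul R B n m = BTensor.tmul R B (r • n) m := by
  rw [BTensor.tmul, ← map_smul, TensorProduct.smul_tmul']; rfl

lemma BTensor.tmul_smul (n : N) (b : B) (m : M) :
    BTensor.tmul R B n (b • m) = BTensor.tmul R B (op b • n) m := by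
  symm
  refine (Submodule.Quotient.eq _).2 ?_
  exact AddSubgroup.subset_closure ⟨n, b, m, rfl⟩

lemma BTensor.tmul_add (n : N) (m m' : M) :
    BTensor.tmul R B n (m + m') = BTensor.tmul R B n m + BTensor.tmul R B n m' := by
  simp only [BTensor.tmul, TensorProduct.tmul_add, map_add]

lemma BTensor.add_tmul (n n' : N) (m : M) :
    BTensor.tmul R B (n + n') m = BTensor.tmul R B n m + BTensor.tmul R B n' m := by
  simp only [BTensor.tmul, TensorProduct.add_tmul, map_add]

lemma BTensor.induction_on {p : BTensor R B N M → Prop} (t : BTensor R B N M) (h0 : p 0)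
    (h1 : ∀ n m, p (BTensor.tmul R B n m)) (h2 : ∀ x y, p x → p y → p (x + y)) : p t := by
  obtain ⟨t, rfl⟩ := (balancedRel R B N M).mkQ_surjective t
  induction t using TensorProduct.induction_on with
  | zero => simpa using h0
  | tmul n m => exact h1 n m
  | add x y hx hy => rw [map_add]; exact h2 _ _ hx hy

/-- A balanced biadditive map induces an additive map on `N ⊗_B M`. -/
def BTensor.lift {A : Type*} [AddCommGroup A] (f : N →+ M →+ A)
    (hf : ∀ n (b : B) m, f (op b • n) m = f n (b • m)) : BTensor R B N M →+ A :=
  QuotientAddGroup.lift (balancedRel R B N M).toAddSubgroup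
    (TensorProduct.liftAddHom f (fun r n m => by simp)) (by
      refine (AddSubgroup.closure_le _).2 ?_
      rintro _ ⟨n, b, m, rfl⟩
      simp [hf])

@[simp] lemma BTensor.lift_tmul {A : Type*} [AddCommGroup A] (f : N →+ M →+ A)
    (hf : ∀ n (b : B) m, f (op b • n) m = f n (b • m)) (n : N) (m : M) :
    BTensor.lift (R := R) f hf (BTensor.tmul R B n m) = f n m := rfl

/-- The `R`-linear version of `BTensor.lift`. -/
def BTensor.liftₗ {A : Type*} [AddCommGroup A] [Module R A] (f : N →+ M →+ A)
    (hf : ∀ n (b : B) m, f (op b • n) m = f n (b • m))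
    (hR : ∀ (r : R) n m, f (r • n) m = r • f n m) : BTensor R B N M →ₗ[R] A where
  __ := BTensor.lift f hf
  map_smul' r t := by
    change BTensor.lift f hf (r • t) = r • BTensor.lift f hf t
    induction t using BTensor.induction_on with
    | h0 => simp
    | h1 n m => rw [BTensor.smul_tmul, BTensor.lift_tmul, BTensor.lift_tmul, hR]
    | h2 x y hx hy => rw [smul_add, map_add, map_add, smul_add, hx, hy]

@[simp] lemma BTensor.liftₗ_tmul {A : Type*} [AddCommGroup A] [Module R A] (f : N →+ M →+ A)
    (hf : ∀ n (b : B) m, f (op b • n) m = f n (b • m))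
    (hR : ∀ (r : R) n m, f (r • n) m = r • f n m) (n : N) (m : M) :
    BTensor.liftₗ f hf hR (BTensor.tmul R B n m) = f n m := rfl

lemma BTensor.hom_ext {A : Type*} [AddCommGroup A] [Module R A] {f g : BTensor R B N M →ₗ[R] A}
    (h : ∀ n m, f (BTensor.tmul R B n m) = g (BTensor.tmul R B n m)) : f = g := by
  refine LinearMap.ext fun t => ?_
  induction t using BTensor.induction_on with
  | h0 => simp
  | h1 n m => exact h n m
  | h2 x y hx hy => rw [map_add, map_add, hx, hy]

/-- The biadditive map `(n, m) ↦ n ⊗ m`. -/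
def BTensor.mk : N →+ M →+ BTensor R B N M :=
  AddMonoidHom.mk' (fun n => AddMonoidHom.mk' (fun m => BTensor.tmul R B n m)
    (BTensor.tmul_add n)) (fun n n' => by ext m; exact BTensor.add_tmul n n' m)

variable {M' : Type w} [AddCommGroup M'] [Module B M']

variable (R N) in
/-- The map `N ⊗_B f : N ⊗_B M → N ⊗_B M'`. -/
def BTensor.map (f : M →ₗ[B] M') : BTensor R B N M →ₗ[R] BTensor R B N M' :=
  BTensor.liftₗ ((BTensor.mk (R := R) (B := B)).compr₂ (AddMonoidHom.id _) |>.compl₂ f.toAddMonoidHom)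
    (fun n b m => by
      change BTensor.tmul R B (op b • n) (f m) = BTensor.tmul R B n (f (b • m))
      rw [map_smul, BTensor.tmul_smul])
    (fun r n m => (BTensor.smul_tmul r n (f m)).symm)

@[simp] lemma BTensor.map_tmul (f : M →ₗ[B] M') (n : N) (m : M) :
    BTensor.map R N f (BTensor.tmul R B n m) = BTensor.tmul R B n (f m) := rfl

/-- `N ⊗_B -` preserves injections if `N` is a projective right `B`-module. -/
lemma BTensor.map_injective [Module.Projective Bᵐᵒᵖ N] (f : M →ₗ[B] M')
    (hf : Function.Injective f) : Function.Injective (BTensor.map R N f) := by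
  obtain ⟨s, hs⟩ := Module.projective_def'.1 (inferInstance : Module.Projective Bᵐᵒᵖ N)
  have hs' : ∀ n, (s n).sum (fun y c => c • y) = n := fun n => by
    simpa [Finsupp.linearCombination_apply] using LinearMap.congr_fun hs n
  -- the coordinate map `n ⊗ m ↦ (y ↦ (s n y) m)`
  let Φ (X : Type w) [AddCommGroup X] [Module B X] : BTensor R B N X →+ (N →₀ X) :=
    BTensor.lift
      (AddMonoidHom.mk' (fun n => AddMonoidHom.mk'
        (fun x => (s n).mapRange (fun c => unop c • x) (by simp))
        (fun x x' => by ext y; simp))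
        (fun n n' => by ext x y; simp [add_smul]))
      (fun n b x => by ext y; simp [mul_smul])
  let Ψ : (N →₀ M) →+ BTensor R B N M := Finsupp.liftAddHom (fun y => BTensor.mk y)
  have hΨ : ∀ t, Ψ (Φ M t) = t := by
    intro t
    induction t using BTensor.induction_on with
    | h0 => simp
    | h1 n m =>
      change Finsupp.sum ((s n).mapRange (fun c => unop c • m) (by simp)) (fun y z => BTensor.mk y z) = _
      rw [Finsupp.sum_mapRange_index (by simp)]
      conv_rhs => rw [← hs' n]
      have : ∀ z : N, BTensor.tmul R B z m = (BTensor.mk (R := R) (B := B)).flip m z := fun _ => rfl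
      rw [this, map_finsuppSum]
      refine Finsupp.sum_congr fun y _ => ?_
      change BTensor.tmul R B y (unop (s n y) • m) = BTensor.tmul R B (s n y • y) m
      rw [BTensor.tmul_smul, op_unop]
    | h2 x y hx hy => rw [map_add, map_add, hx, hy]
  have hnat : ∀ t, Φ M' (BTensor.map R N f t) = (Φ M t).mapRange f (map_zero f) := by
    intro t
    induction t using BTensor.induction_on with
    | h0 => simp
    | h1 n m =>
      ext y
      change unop (s n y) • f m = f (unop (s n y) • m)
      rw [map_smul]
    | h2 x y hx hy => rw [map_add, map_add, map_add, hx, hy]; ext z; simp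
  rw [injective_iff_map_eq_zero]
  intro t ht
  have h1 := hnat t
  rw [ht, map_zero] at h1
  have h2 : Φ M t = 0 := by
    ext y
    apply hf
    have := DFunLike.congr_fun h1 y
    simpa using this.symm
  rw [← hΨ t, h2, map_zero]

end Balanced

/-- A `B`-`B`-bimodule `U` is left projectivising if `U ⊗_B X` is a projective left `B`-module
for every left `B`-module `X`. -/
def LeftProjectivising (B : Type u) [Ring B] (U : Type u) [AddCommGroup U] [Module B U]
    [Module Bᵐᵒᵖ U] [SMulCommClass B Bᵐᵒᵖ U] : Prop :=
  ∀ (X : Type u) [AddCommGroup X] [Module B X], Module.Projective B (BTensor B B U X)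

section Extension

variable {Λ : Type u} [Ring Λ] (B : Subring Λ)

/-- `Λ` as a right module over a subring `B`. -/
instance rightModule : Module (B : Type u)ᵐᵒᵖ Λ := Module.compHom Λ B.subtype.op

lemma op_smul_def (b : B) (x : Λ) : op b • x = x * (b : Λ) := rfl

instance : SMulCommClass Λ (B : Type u)ᵐᵒᵖ Λ where
  smul_comm x b y := (mul_assoc x y (b.unop : Λ)).symm

/-- The induction functor `Λ ⊗_B -` from left `B`-modules to left `Λ`-modules. -/
def induction : ModuleCat.{u} B ⥤ ModuleCat.{u} Λ where
  obj M := ModuleCat.of Λ (BTensor Λ B Λ M)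
  map f := ModuleCat.ofHom (BTensor.map Λ Λ f.hom)
  map_id M := by
    ext : 1
    exact BTensor.hom_ext fun n m => rfl
  map_comp f g := by
    ext : 1
    exact BTensor.hom_ext fun n m => rfl

instance : (induction B).Additive where
  map_add {M M' f g} := by
    ext : 1
    exact BTensor.hom_ext fun n m => BTensor.tmul_add n (f.hom m) (g.hom m)

/-- Induction is left adjoint to restriction of scalars along `B ⊆ Λ`. -/
def inductionAdj : induction B ⊣ ModuleCat.restrictScalars.{u} B.subtype :=
  Adjunction.mkOfHomEquiv
    { homEquiv := fun M L =>
        { toFun := fun g => ModuleCat.ofHom (Y := (ModuleCat.restrictScalars B.subtype).obj L)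
            { toFun := fun m => g.hom (BTensor.tmul Λ B 1 m)
              map_add' := fun m m' =>
                (congrArg g.hom (BTensor.tmul_add 1 m m')).trans (g.hom.map_add _ _)
              map_smul' := fun b m => by
                refine Eq.trans (congrArg g.hom ?_)
                  (g.hom.map_smul (b : Λ) (BTensor.tmul Λ B (1 : Λ) m))
                refine Eq.trans ?_ (BTensor.smul_tmul (b : Λ) (1 : Λ) m).symm
                rw [BTensor.tmul_smul, op_smul_def, one_mul, smul_eq_mul, mul_one] }
          invFun := fun h => ModuleCat.ofHom (BTensor.liftₗ
            (A := L)
            (AddMonoidHom.mk' (fun x => AddMonoidHom.mk' (fun m => x • (show L from h.hom m))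
              (fun m m' => by rw [map_add]; exact smul_add x _ _))
              (fun x x' => by ext m; exact add_smul x x' (show L from h.hom m)))
            (fun x b m => by
              change (x * (b : Λ)) • (show L from h.hom m) = x • (show L from h.hom (b • m))
              rw [map_smul, mul_smul]; rfl)
            (fun r x m => mul_smul r x (show L from h.hom m)))
          left_inv := fun g => by
            ext : 1
            refine BTensor.hom_ext fun x m => ?_
            change x • g.hom (BTensor.tmul Λ B 1 m) = g.hom (BTensor.tmul Λ B x m)
            refine (g.hom.map_smul x (BTensor.tmul Λ B (1 : Λ) m)).symm.trans (congrArg g.hom ?_)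
            refine (BTensor.smul_tmul x (1 : Λ) m).trans ?_
            rw [smul_eq_mul, mul_one]
          right_inv := fun h => by
            ext m
            exact one_smul Λ (show L from h.hom m) }
      homEquiv_naturality_left_symm := fun f g => by
        ext : 1
        exact BTensor.hom_ext fun x m => rfl
      homEquiv_naturality_right := fun f g => rfl }

instance : PreservesFiniteColimits (induction B) :=
  have := (inductionAdj B).leftAdjoint_preservesColimits
  inferInstance

/-- Induction is exact if `Λ` is projective as a right `B`-module. -/
instance [Module.Projective (B : Type u)ᵐᵒᵖ Λ] : PreservesFiniteLimits (induction B) := by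
  have : (induction B).PreservesMonomorphisms :=
    ⟨fun f hf => (ModuleCat.mono_iff_injective _).2
      (BTensor.map_injective f.hom ((ModuleCat.mono_iff_injective f).1 hf))⟩
  have := (induction B).preservesHomology_of_preservesMonos_and_cokernels
  exact (induction B).preservesFiniteLimits_of_preservesHomology

/-- The map `Ext^i_B(M, N) → Ext^i_Λ(Λ ⊗_B M, Λ ⊗_B N)` induced by the induction functor. -/
def inducedExt [Module.Projective (B : Type u)ᵐᵒᵖ Λ] (M N : ModuleCat.{u} B) (i : ℕ) :
    Abelian.Ext.{u} M N i →+ Abelian.Ext.{u} ((induction B).obj M) ((induction B).obj N) i :=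
  (induction B).mapExtAddHom M N i

/-- The right dual `W = Hom_{Bᵒᵖ}(Λ, B)`: right `B`-linear maps `Λ → B`. -/
def RightDual : Type u := Λ →ₗ[(B : Type u)ᵐᵒᵖ] B

namespace RightDual

instance : AddCommGroup (RightDual B) := inferInstanceAs (AddCommGroup (Λ →ₗ[(B : Type u)ᵐᵒᵖ] B))

instance : FunLike (RightDual B) Λ B := inferInstanceAs (FunLike (Λ →ₗ[(B : Type u)ᵐᵒᵖ] B) Λ B)

variable {B}

@[ext] lemma ext {f g : RightDual B} (h : ∀ x, f x = g x) : f = g := DFunLike.ext f g h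

@[simp] lemma add_apply (f g : RightDual B) (x : Λ) : (f + g) x = f x + g x := rfl

@[simp] lemma zero_apply (x : Λ) : (0 : RightDual B) x = 0 := rfl

lemma map_add (f : RightDual B) (x y : Λ) : f (x + y) = f x + f y :=
  LinearMap.map_add (show Λ →ₗ[(B : Type u)ᵐᵒᵖ] B from f) x y

lemma map_mul (f : RightDual B) (x : Λ) (b : B) : f (x * b) = f x * b :=
  LinearMap.map_smul (show Λ →ₗ[(B : Type u)ᵐᵒᵖ] B from f) (op b) x

/-- The left action `(b f)(x) = b f(x)`. -/
instance : Module B (RightDual B) where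
  smul b f := ({ toFun := fun x => b * f x
                 map_add' := fun x y => by rw [map_add, mul_add]
                 map_smul' := fun c x => by
                  change b * f (x * (c.unop : Λ)) = (b * f x) * c.unop
                  rw [map_mul, mul_assoc] } : Λ →ₗ[(B : Type u)ᵐᵒᵖ] B)
  one_smul f := ext fun x => one_mul (f x)
  mul_smul b c f := ext fun x => mul_assoc b c (f x)
  smul_zero b := ext fun x => mul_zero b
  smul_add b f g := ext fun x => mul_add b (f x) (g x)
  add_smul b c f := ext fun x => add_mul b c (f x)
  zero_smul f := ext fun x => zero_mul (f x)

/-- The right action `(f b)(x) = f(b x)`. -/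
instance : Module (B : Type u)ᵐᵒᵖ (RightDual B) where
  smul b f := ({ toFun := fun x => f ((b.unop : Λ) * x)
                 map_add' := fun x y => by rw [mul_add, map_add]
                 map_smul' := fun c x => by
                  change f ((b.unop : Λ) * (x * (c.unop : Λ))) = f ((b.unop : Λ) * x) * c.unop
                  rw [← mul_assoc, map_mul] } : Λ →ₗ[(B : Type u)ᵐᵒᵖ] B)
  one_smul f := ext fun x => congrArg f (one_mul x)
  mul_smul b c f := ext fun x => congrArg f (mul_assoc (c.unop : Λ) (b.unop : Λ) x)
  smul_zero b := rfl
  smul_add b f g := rfl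
  add_smul b c f := ext fun x =>
    (congrArg f (add_mul (b.unop : Λ) (c.unop : Λ) x)).trans (map_add f _ _)
  zero_smul f := ext fun x => (congrArg f (zero_mul x)).trans
    (LinearMap.map_zero (show Λ →ₗ[(B : Type u)ᵐᵒᵖ] B from f))

lemma smul_apply (b : B) (f : RightDual B) (x : Λ) : (b • f) x = b * f x := rfl

lemma op_smul_apply (b : B) (f : RightDual B) (x : Λ) : (op b • f) x = f (b * x) := rfl

instance : SMulCommClass B (B : Type u)ᵐᵒᵖ (RightDual B) where
  smul_comm _ _ _ := rfl

variable (B)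

/-- The counit `ε : W → B`, `f ↦ f(1)`, as a map of left `B`-modules. -/
def counit : RightDual B →ₗ[B] B where
  toFun f := f 1
  map_add' _ _ := rfl
  map_smul' _ _ := rfl

variable {B} in
/-- The counit is also a map of right `B`-modules. -/
lemma counit_op_smul (b : B) (f : RightDual B) : counit B (op b • f) = counit B f * b := by
  change f ((b : Λ) * 1) = f 1 * b
  rw [← map_mul, mul_one, one_mul]

/-- The kernel of the counit. -/
abbrev CounitKer : Type u := LinearMap.ker (counit B)

/-- The kernel of the counit is a sub-bimodule of `W`; its right action is that of `W`. -/
instance : Module (B : Type u)ᵐᵒᵖ (CounitKer B) where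
  smul b f := ⟨b • (f : RightDual B), by
    have hf : counit B f = 0 := f.2
    have h := counit_op_smul b.unop (f : RightDual B)
    rw [hf, zero_mul] at h
    exact h⟩
  one_smul f := Subtype.ext (one_smul _ (f : RightDual B))
  mul_smul b c f := Subtype.ext (mul_smul b c (f : RightDual B))
  smul_zero b := Subtype.ext (smul_zero b)
  smul_add b f g := Subtype.ext (smul_add b (f : RightDual B) g)
  add_smul b c f := Subtype.ext (add_smul b c (f : RightDual B))
  zero_smul f := Subtype.ext (zero_smul _ (f : RightDual B))

instance : SMulCommClass B (B : Type u)ᵐᵒᵖ (CounitKer B) where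
  smul_comm _ _ _ := rfl

end RightDual

end Extension

end RingExt

end

noncomputable section

namespace RingExt

/-! ### Ext groups and the unit of an adjunction with exact left adjoint. -/

section Adjunction

variable {C D : Type*} [Category C] [Category D] [Abelian C] [Abelian D]
  [HasExt.{u} C] [HasExt.{u} D]
  {F : C ⥤ D} {G : D ⥤ C} (adj : F ⊣ G) [F.Additive] [PreservesFiniteLimits F]
  [PreservesFiniteColimits F]

/-! Write `W̄` for the kernel of the counit. A finite dual basis of `Λ`, together with some `f₀ ∈ W`
with `f₀(1) = 1`, identifies the cokernel of the unit `N → Λ ⊗_B N` with `Hom_B(W̄, N)`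
(`shortExact_unit_toBimoduleHom`). By adjunction, the hypothesis on Ext says that composing with
this unit is onto on `Ext¹_B(M, -)` and injective on `Ext²_B(M, -)`, so the long exact sequence
forces `Ext¹_B(M, Hom_B(W̄, N)) = 0` for all `M`: every `Hom_B(W̄, N)` is injective
(`injective_of_shortExact_unit`).

As `W̄` is left projective, a surjection `M → N` with kernel `K` gives a short exact sequence of
modules `Hom_B(W̄, -)`. It splits because `Hom_B(W̄, K)` is injective, and by tensor-hom adjunction
every map `W̄ ⊗_B X → N` lifts to `M` (`leftProjectivising_of_injective`). -/

lemma comp_mk₀_sub {X Y Z : C} {n : ℕ} (e : Abelian.Ext.{u} X Y n) (f g : Y ⟶ Z) :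
    e.comp (Abelian.Ext.mk₀ (f - g)) (add_zero n) =
      e.comp (Abelian.Ext.mk₀ f) (add_zero n) - e.comp (Abelian.Ext.mk₀ g) (add_zero n) := by
  rw [sub_eq_add_neg, Abelian.Ext.mk₀_add, Abelian.Ext.mk₀_neg, Abelian.Ext.comp_add,
    Abelian.Ext.comp_neg, sub_eq_add_neg]

-- Transpose `hg` across the adjunction: `F.map k` corresponds to `k` followed by the unit. This
-- turns an equality of extension classes over `D` into one over `C`.
omit [Abelian C] [Abelian D] [HasExt.{u} C] [HasExt.{u} D] [F.Additive] [PreservesFiniteLimits F]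
  [PreservesFiniteColimits F] in
lemma comp_unit_eq_add [Preadditive C] [Preadditive D] [F.Additive] {X Y N : C} (f : X ⟶ Y)
    (k : X ⟶ N) (h : X ⟶ G.obj (F.obj N)) (g : F.obj Y ⟶ F.obj N)
    (hg : F.map f ≫ g = F.map k - (adj.homEquiv _ _).symm h) :
    k ≫ adj.unit.app N = h + f ≫ adj.homEquiv _ _ g := by
  rw [← sub_eq_iff_eq_add', ← adj.homEquiv_naturality_left, hg, ← Equiv.symm_apply_eq]
  simp [Adjunction.homEquiv_counit, Preadditive.sub_comp]

include adj in
/-- If `F` is surjective on `Ext¹(M, N)`, then so is composition with the unit `N ⟶ G (F N)` of an adjunction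
`F ⊣ G`. -/
lemma exists_comp_unit_eq [EnoughProjectives C] {M N : C}
    (hsurj : Function.Surjective (F.mapExtAddHom M N 1 :
      Abelian.Ext.{u} M N 1 →+ Abelian.Ext.{u} (F.obj M) (F.obj N) 1))
    (y : Abelian.Ext.{u} M (G.obj (F.obj N)) 1) :
    ∃ z : Abelian.Ext.{u} M N 1,
      z.comp (Abelian.Ext.mk₀ (adj.unit.app N)) (add_zero 1) = y := by
  let S : ShortComplex C := ShortComplex.mk (kernel.ι (Projective.π M)) (Projective.π M)
    (kernel.condition _)
  have hS : S.ShortExact :=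
    { exact := ShortComplex.exact_of_f_is_kernel _ (kernelIsKernel (Projective.π M))
      mono_f := inferInstanceAs (Mono (kernel.ι (Projective.π M)))
      epi_g := inferInstanceAs (Epi (Projective.π M)) }
  have : Projective S.X₂ := inferInstanceAs (Projective (Projective.over M))
  -- Dimension shifting: `Ext¹` out of the projective middle term vanishes, so each class on `M` is
  -- a pushout of the syzygy extension.
  have lift : ∀ {Z : C} (y : Abelian.Ext.{u} M Z 1), ∃ h : S.X₁ ⟶ Z,
      hS.extClass.comp (Abelian.Ext.mk₀ h) (add_zero 1) = y := fun {Z} y => by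
    obtain ⟨h, hh⟩ := Abelian.Ext.contravariant_sequence_exact₃ hS Z y
      (Abelian.Ext.eq_zero_of_projective _) (add_zero 1)
    obtain ⟨h, rfl⟩ := (Abelian.Ext.mk₀_bijective _ _).2 h
    exact ⟨h, hh⟩
  obtain ⟨h, rfl⟩ := lift y
  obtain ⟨z, hz⟩ := hsurj ((hS.map_of_exact F).extClass.comp
    (Abelian.Ext.mk₀ ((adj.homEquiv _ _).symm h)) (add_zero 1))
  obtain ⟨k, rfl⟩ := lift z
  refine ⟨hS.extClass.comp (Abelian.Ext.mk₀ k) (add_zero 1),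
    (Abelian.Ext.comp_assoc_of_third_deg_zero _ _ _ _).trans ?_⟩
  rw [Functor.mapExtAddHom_apply, Abelian.Ext.mapExactFunctor_comp,
    Abelian.Ext.mapExactFunctor_extClass, Abelian.Ext.mapExactFunctor_mk₀] at hz
  -- Two maps give the same pushout of the extension `F S` only if their difference extends along
  -- `F.map S.f`; `g` is such an extension.
  obtain ⟨g, hg⟩ := Abelian.Ext.contravariant_sequence_exact₁ (hS.map_of_exact F) _
    (Abelian.Ext.mk₀ (F.map k - (adj.homEquiv _ _).symm h)) (add_zero 1)
    ((comp_mk₀_sub _ _ _).trans (sub_eq_zero.2 hz))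
  obtain ⟨g, rfl⟩ := (Abelian.Ext.mk₀_bijective _ _).2 g
  rw [Abelian.Ext.mk₀_comp_mk₀] at hg
  have hg : F.map S.f ≫ g = F.map k - (adj.homEquiv _ _).symm h :=
    (Abelian.Ext.mk₀_bijective _ _).1 hg
  have key := comp_unit_eq_add adj S.f k h g hg
  rw [Abelian.Ext.mk₀_comp_mk₀, key, Abelian.Ext.mk₀_add, Abelian.Ext.comp_add,
    ← Abelian.Ext.mk₀_comp_mk₀, hS.extClass_comp_assoc, add_zero]

/-- If `F ⊣ G` with `F` surjective on `Ext¹(-, N)` and injective on `Ext²(-, N)`, then the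
cokernel of the unit `N ⟶ G (F N)` is injective if the unit is a monomorphism. -/
lemma injective_of_shortExact_unit [EnoughProjectives C] {N Q : C}
    (hsurj : ∀ M, Function.Surjective (F.mapExtAddHom M N 1 :
      Abelian.Ext.{u} M N 1 →+ Abelian.Ext.{u} (F.obj M) (F.obj N) 1))
    (hinj : ∀ M, Function.Injective (F.mapExtAddHom M N 2 :
      Abelian.Ext.{u} M N 2 →+ Abelian.Ext.{u} (F.obj M) (F.obj N) 2))
    (p : G.obj (F.obj N) ⟶ Q) (w : adj.unit.app N ≫ p = 0)
    (hS : (ShortComplex.mk _ _ w).ShortExact) : Injective Q := by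
  rw [injective_iff_subsingleton_ext_one.{u}]
  intro M
  refine subsingleton_of_forall_eq 0 fun x => ?_
  -- The connecting class of `x` dies after composing with the unit. Its image under `F` then dies
  -- after composing with `F` of the unit, which the counit splits by a triangle identity;
  -- injectivity in degree 2 concludes.
  have hx : x.comp hS.extClass (rfl : 1 + 1 = 2) = 0 := by
    refine hinj M ?_
    rw [map_zero]
    have h1 : (x.comp hS.extClass (rfl : 1 + 1 = 2)).comp
        (Abelian.Ext.mk₀ (adj.unit.app N)) (add_zero 2) = 0 := by
      have := hS.extClass_comp
      rw [Abelian.Ext.comp_assoc_of_third_deg_zero]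
      erw [this]
      simp
    replace h1 := congrArg (Abelian.Ext.mapExactFunctor F) h1
    rw [Abelian.Ext.mapExactFunctor_comp, Abelian.Ext.mapExactFunctor_mk₀,
      Abelian.Ext.mapExactFunctor_zero] at h1
    replace h1 := congrArg (fun e => e.comp
      (Abelian.Ext.mk₀ (adj.counit.app (F.obj N))) (add_zero 2)) h1
    simpa using h1
  -- Now `x` comes from some `y` via `p`, and `y` from some `z` via the unit, so `x` factors through
  -- unit followed by `p`, which is zero.
  obtain ⟨y, rfl⟩ := Abelian.Ext.covariant_sequence_exact₃ M hS x rfl hx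
  obtain ⟨z, rfl⟩ := exists_comp_unit_eq adj (hsurj M) y
  dsimp
  rw [Abelian.Ext.comp_assoc_of_third_deg_zero, Abelian.Ext.mk₀_comp_mk₀, w]
  simp

end Adjunction

/-! ### Hom out of a bimodule, and the projectivity criterion. -/

section BimoduleHom

variable (R : Type u) [Ring R] (U : Type u) [AddCommGroup U] [Module R U] [Module Rᵐᵒᵖ U]
  [SMulCommClass R Rᵐᵒᵖ U] (N : Type u) [AddCommGroup N] [Module R N]

/-- The left `R`-module `Hom_R(U, N)` for an `R`-`R`-bimodule `U` and a left `R`-module `N`. -/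
def BimoduleHom : Type u := U →ₗ[R] N

namespace BimoduleHom

instance : AddCommGroup (BimoduleHom R U N) := inferInstanceAs (AddCommGroup (U →ₗ[R] N))

variable {R U N}

/-- The underlying linear map of an element of `Hom_R(U, N)`. -/
def toLinear (φ : BimoduleHom R U N) : U →ₗ[R] N := φ

omit [Module Rᵐᵒᵖ U] [SMulCommClass R Rᵐᵒᵖ U] in
@[ext] lemma ext {φ ψ : BimoduleHom R U N} (h : ∀ x, φ.toLinear x = ψ.toLinear x) : φ = ψ :=
  LinearMap.ext h

/-- The left action `(r φ)(x) = φ(x r)`. -/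
instance : Module R (BimoduleHom R U N) where
  smul r φ := ({ toFun := fun x => φ.toLinear (op r • x)
                 map_add' := fun x y => by rw [smul_add, map_add]
                 map_smul' := fun c x => by
                  rw [← smul_comm, map_smul, RingHom.id_apply] } : U →ₗ[R] N)
  one_smul φ := ext fun x => congrArg φ.toLinear (one_smul _ x)
  mul_smul r s φ := ext fun x => congrArg φ.toLinear (mul_smul (op s) (op r) x)
  smul_zero r := rfl
  smul_add r φ ψ := rfl
  add_smul r s φ := ext fun x =>
    (congrArg φ.toLinear (add_smul (op r) (op s) x)).trans (map_add φ.toLinear _ _)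
  zero_smul φ := ext fun x =>
    (congrArg φ.toLinear (zero_smul _ x)).trans (map_zero φ.toLinear)

/-- The map `Hom_R(U, N) → Hom_R(U, N')` induced by a map `N → N'`. -/
def map {N' : Type u} [AddCommGroup N'] [Module R N'] (f : N →ₗ[R] N') :
    BimoduleHom R U N →ₗ[R] BimoduleHom R U N' where
  toFun φ := (f ∘ₗ φ.toLinear : U →ₗ[R] N')
  map_add' φ ψ := LinearMap.comp_add _ _ _
  map_smul' r φ := by ext x; rfl

end BimoduleHom

variable {R U}

/-- If `U` is projective as a left `R`-module and all `R`-modules `Hom_R(U, N)` are injective, then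
`U` is left projectivising. -/
lemma leftProjectivising_of_injective [Module.Projective R U]
    (h : ∀ (N : Type u) [AddCommGroup N] [Module R N],
      Injective (ModuleCat.of R (BimoduleHom R U N))) :
    LeftProjectivising R U := by
  intro X _ _
  refine Module.Projective.of_lifting_property fun {M N} _ _ _ _ f g hf => ?_
  let S : ShortComplex (ModuleCat.{u} R) := ShortComplex.mk
    (ModuleCat.ofHom (BimoduleHom.map (R := R) (U := U) (LinearMap.ker f).subtype))
    (ModuleCat.ofHom (BimoduleHom.map f)) (by
      ext φ x
      exact (φ.toLinear x).2)
  have hS : S.ShortExact :=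
    { exact := (ShortComplex.moduleCat_exact_iff _).2 fun φ hφ =>
        ⟨(LinearMap.codRestrict (LinearMap.ker f) (BimoduleHom.toLinear φ) fun x =>
          congrArg (fun ψ => BimoduleHom.toLinear ψ x) hφ : U →ₗ[R] LinearMap.ker f), rfl⟩
      mono_f := (ModuleCat.mono_iff_injective _).2 fun φ ψ hφψ =>
        BimoduleHom.ext fun x => Subtype.ext (congrArg (fun χ => BimoduleHom.toLinear χ x) hφψ)
      epi_g := (ModuleCat.epi_iff_surjective _).2 fun φ =>
        -- Right exactness is where left projectivity of `U` enters.
        Module.projective_lifting_property f (BimoduleHom.toLinear φ) hf }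
  have : Injective S.X₁ := h _
  let σ := hS.splittingOfInjective
  -- `γ` is the tensor-hom transpose of `g`. The section `σ.s` lifts it to `δ`, whose transpose is
  -- the required lift of `g`.
  let γ : X →ₗ[R] BimoduleHom R U N :=
    { toFun := fun x => ({ toFun := fun n => g (BTensor.tmul R R n x)
                           map_add' := fun n n' => by rw [BTensor.add_tmul, map_add]
                           map_smul' := fun r n => by
                            rw [← BTensor.smul_tmul, map_smul]; rfl } : U →ₗ[R] N)
      map_add' := fun x x' => LinearMap.ext fun n =>
        (congrArg g (BTensor.tmul_add n x x')).trans (map_add g _ _)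
      map_smul' := fun r x => LinearMap.ext fun n => congrArg g (BTensor.tmul_smul n r x) }
  let δ : X →ₗ[R] BimoduleHom R U M := σ.s.hom ∘ₗ γ
  have hδ : ∀ n x, f ((δ x).toLinear n) = g (BTensor.tmul R R n x) := fun n x =>
    congrArg (fun ψ => BimoduleHom.toLinear ψ n)
      (LinearMap.congr_fun (congrArg ModuleCat.Hom.hom σ.s_g) (γ x))
  refine ⟨BTensor.liftₗ (AddMonoidHom.mk' (fun n => AddMonoidHom.mk'
      (fun x => (δ x).toLinear n) fun x x' => by rw [map_add]; rfl)
      fun n n' => by ext x; exact LinearMap.map_add (δ x) n n')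
    (fun n r x => by
      change (δ x).toLinear _ = (δ (r • x)).toLinear n
      rw [map_smul δ]; rfl)
    (fun r n x => LinearMap.map_smul (δ x) r n), BTensor.hom_ext fun n x => hδ n x⟩

end BimoduleHom

/-! ### The dual coring `W` and the cokernel of the unit. -/

section Extension

variable {Λ : Type u} [Ring Λ] (B : Subring Λ)

/-- A finitely generated projective right module has a finite dual basis. -/
lemma exists_dual_basis [Module.Finite (B : Type u)ᵐᵒᵖ Λ] [Module.Projective (B : Type u)ᵐᵒᵖ Λ] :
    ∃ (n : ℕ) (e : Fin n → Λ) (f : Fin n → RightDual B), ∀ x, ∑ i, e i * (f i x : Λ) = x := by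
  obtain ⟨n, p, s, -, -, hps⟩ := Module.Finite.exists_comp_eq_id_of_projective (B : Type u)ᵐᵒᵖ Λ
  refine ⟨n, fun i => p (Pi.single i 1), fun i =>
    ({ toFun := fun x => unop (s x i)
       map_add' := fun x y => by simp
       map_smul' := fun b x => by simp } : Λ →ₗ[(B : Type u)ᵐᵒᵖ] B), fun x => ?_⟩
  have h := LinearMap.congr_fun hps x
  rw [LinearMap.comp_apply, pi_eq_sum_univ' (s x), map_sum] at h
  refine Eq.trans (Finset.sum_congr rfl fun i _ => ?_) h
  rw [map_smul, ← op_unop (s x i)]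
  rfl

/-- If `Λ` is a generator of the category of right `B`-modules, the counit is surjective. -/
lemma exists_apply_one_eq_one
    (hgen : IsSeparator (ModuleCat.of.{u} (B : Type u)ᵐᵒᵖ Λ)) : ∃ f : RightDual B, f 1 = 1 := by
  let T : Submodule (B : Type u)ᵐᵒᵖ B :=
    { carrier := Set.range fun f : RightDual B => f 1
      add_mem' := by
        rintro _ _ ⟨f, rfl⟩ ⟨g, rfl⟩
        exact ⟨f + g, rfl⟩
      zero_mem' := ⟨0, rfl⟩
      smul_mem' := by
        rintro b _ ⟨f, rfl⟩
        exact ⟨b • f, RightDual.counit_op_smul b.unop f⟩ }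
  -- For `h : Λ → B` and `x ∈ Λ`, the value `h x` is that of `y ↦ h (x * y)` at `1`, so it lies in
  -- `T`. Thus `B → B ⧸ T` kills every map from the generator `Λ`, hence is zero, and `1 ∈ T`.
  have key := (isSeparator_def _).1 hgen (X := ModuleCat.of (B : Type u)ᵐᵒᵖ B)
    (Y := ModuleCat.of (B : Type u)ᵐᵒᵖ (B ⧸ T)) (ModuleCat.ofHom T.mkQ) 0 fun h => by
      ext x
      refine (Submodule.Quotient.mk_eq_zero T).2 ?_
      refine ⟨(h.hom ∘ₗ ({ toFun := fun y => x * y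
                           map_add' := mul_add x
                           map_smul' := fun b y => (mul_assoc x y _).symm } :
          Λ →ₗ[(B : Type u)ᵐᵒᵖ] Λ) : Λ →ₗ[(B : Type u)ᵐᵒᵖ] B), ?_⟩
      exact congrArg h.hom (mul_one x)
  exact (Submodule.Quotient.mk_eq_zero T).1
    (LinearMap.congr_fun (congrArg ModuleCat.Hom.hom key) (1 : B))

variable {B}

lemma RightDual.sum_apply {ι : Type*} (s : Finset ι) (f : ι → RightDual B) (x : Λ) :
    (∑ i ∈ s, f i) x = ∑ i ∈ s, f i x :=
  map_sum (AddMonoidHom.mk' (fun g : RightDual B => g x) fun _ _ => rfl) f s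

/-- The elements `fᵢ` of a finite dual basis generate `W` as a left `B`-module. -/
lemma sum_smul_dual_basis {n : ℕ} {e : Fin n → Λ} {f : Fin n → RightDual B}
    (hef : ∀ x, ∑ i, e i * (f i x : Λ) = x) (w : RightDual B) : ∑ i, w (e i) • f i = w := by
  ext x : 1
  rw [RightDual.sum_apply]
  conv_rhs => rw [← hef x]
  refine Eq.trans ?_ (map_sum (AddMonoidHom.mk' w (RightDual.map_add w)) _ _).symm
  exact Finset.sum_congr rfl fun i _ => (RightDual.map_mul w _ _).symm

/-- The left `B`-linear projection of `W` onto the kernel of the counit given by an element `f₀`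
with `f₀(1) = 1`. -/
def counitKerProj (f₀ : RightDual B) (h₀ : f₀ 1 = 1) : RightDual B →ₗ[B] RightDual.CounitKer B :=
  LinearMap.codRestrict _
    (LinearMap.id - LinearMap.toSpanSingleton B _ f₀ ∘ₗ RightDual.counit B) fun f => by
      rw [LinearMap.mem_ker, LinearMap.sub_apply, map_sub, LinearMap.comp_apply,
        LinearMap.toSpanSingleton_apply, map_smul, sub_eq_zero]
      change f 1 = f 1 * f₀ 1
      rw [h₀, mul_one]

lemma counitKerProj_apply (f₀ : RightDual B) (h₀ : f₀ 1 = 1) (f : RightDual B) :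
    (counitKerProj f₀ h₀ f : RightDual B) = f - f 1 • f₀ := rfl

lemma counitKerProj_coe (f₀ : RightDual B) (h₀ : f₀ 1 = 1) (f : RightDual.CounitKer B) :
    counitKerProj f₀ h₀ f = f := by
  refine Subtype.ext ?_
  have hf : (f : RightDual B) 1 = 0 := f.2
  rw [counitKerProj_apply, hf, zero_smul, sub_zero]

/-- The dual basis makes `W` a retract of `B^n` through `w ↦ (w (e i))ᵢ`, and `f₀` splits the kernel
off `W`. -/
lemma projective_counitKer {n : ℕ} {e : Fin n → Λ} {f : Fin n → RightDual B}
    (hef : ∀ x, ∑ i, e i * (f i x : Λ) = x) (f₀ : RightDual B) (h₀ : f₀ 1 = 1) :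
    Module.Projective B (RightDual.CounitKer B) := by
  refine Module.Projective.of_split (M := Fin n → B)
    { toFun := fun w i => (w : RightDual B) (e i)
      map_add' := fun _ _ => rfl
      map_smul' := fun _ _ => rfl }
    (counitKerProj f₀ h₀ ∘ₗ Fintype.linearCombination B f) (LinearMap.ext fun w => ?_)
  refine Eq.trans ?_ (counitKerProj_coe f₀ h₀ w)
  exact congrArg (counitKerProj f₀ h₀) (sum_smul_dual_basis hef w)

variable {N : Type u} [AddCommGroup N] [Module B N]

/-- The map `Λ ⊗_B N → N`, `x ⊗ n ↦ f(x) n`, for `f ∈ W`. -/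
def dualEval (f : RightDual B) : BTensor Λ B Λ N →+ N :=
  BTensor.lift (AddMonoidHom.mk' (fun x => AddMonoidHom.mk' (fun n => f x • n) (smul_add (f x)))
    fun x y => by ext n; exact (congrArg (· • n) (RightDual.map_add f x y)).trans (add_smul _ _ n))
    fun x b n => (congrArg (· • n) (RightDual.map_mul f x b)).trans (mul_smul _ _ n)

@[simp] lemma dualEval_tmul (f : RightDual B) (x : Λ) (n : N) :
    dualEval f (BTensor.tmul Λ B x n) = f x • n := rfl

lemma dualEval_add (f g : RightDual B) (t : BTensor Λ B Λ N) :
    dualEval (f + g) t = dualEval f t + dualEval g t := by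
  induction t using BTensor.induction_on with
  | h0 => simp
  | h1 x n => exact add_smul _ _ n
  | h2 x y hx hy => rw [map_add, map_add, map_add, hx, hy]; abel

lemma dualEval_smul (b : B) (f : RightDual B) (t : BTensor Λ B Λ N) :
    dualEval (b • f) t = b • dualEval f t := by
  induction t using BTensor.induction_on with
  | h0 => simp
  | h1 x n => exact mul_smul _ _ n
  | h2 x y hx hy => rw [map_add, map_add, smul_add, hx, hy]

lemma dualEval_op_smul (b : B) (f : RightDual B) (t : BTensor Λ B Λ N) :
    dualEval (op b • f) t = dualEval f ((b : Λ) • t) := by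
  induction t using BTensor.induction_on with
  | h0 => simp
  | h1 x n => rw [BTensor.smul_tmul]; rfl
  | h2 x y hx hy => rw [smul_add, map_add, map_add, hx, hy]

/-- On `x ⊗ m` the scalars `f i x` move across the tensor sign, leaving the dual basis expansion of
`x`. -/
lemma sum_tmul_dualEval {n : ℕ} {e : Fin n → Λ} {f : Fin n → RightDual B}
    (hef : ∀ x, ∑ i, e i * (f i x : Λ) = x) (t : BTensor Λ B Λ N) :
    ∑ i, BTensor.tmul Λ B (e i) (dualEval (f i) t) = t := by
  induction t using BTensor.induction_on with
  | h0 => exact Finset.sum_eq_zero fun i _ => by rw [map_zero]; exact map_zero (BTensor.mk (e i))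
  | h1 x m =>
    conv_rhs => rw [← hef x]
    refine Eq.trans ?_ (map_sum ((BTensor.mk (R := Λ) (B := B) (N := Λ)).flip m) _ _).symm
    exact Finset.sum_congr rfl fun i _ => BTensor.tmul_smul (e i) (f i x) m
  | h2 x y hx hy =>
    simp only [map_add, BTensor.tmul_add, Finset.sum_add_distrib, hx, hy]

/-- If `t ∈ Λ ⊗_B N` is killed by the kernel of the counit, then `t` is of the form `1 ⊗ n`. -/
lemma eq_one_tmul_of_dualEval_eq_zero {n : ℕ} {e : Fin n → Λ} {f : Fin n → RightDual B}
    (hef : ∀ x, ∑ i, e i * (f i x : Λ) = x) (f₀ : RightDual B) (h₀ : f₀ 1 = 1)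
    (t : BTensor Λ B Λ N) (ht : ∀ w : RightDual.CounitKer B, dualEval (w : RightDual B) t = 0) :
    BTensor.tmul Λ B 1 (dualEval f₀ t) = t := by
  conv_rhs => rw [← sum_tmul_dualEval hef t]
  conv_lhs => rw [← hef 1]
  refine (map_sum ((BTensor.mk (R := Λ) (B := B) (N := Λ)).flip (dualEval f₀ t)) _ _).trans ?_
  refine Finset.sum_congr rfl fun i _ => ?_
  -- Modulo the kernel of the counit, `f i` is `f i 1 • f₀`; the coefficients `f i 1` are those of
  -- `1 = ∑ e i * f i 1`.
  have h : f i = (counitKerProj f₀ h₀ (f i) : RightDual B) + f i 1 • f₀ := by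
    rw [counitKerProj_apply, sub_add_cancel]
  conv_rhs => rw [h, dualEval_add, ht, zero_add, dualEval_smul, BTensor.tmul_smul]
  rfl

variable (B N) in
/-- The map `Λ ⊗_B N → Hom_B(W̄, N)` sending `x ⊗ n` to `f ↦ f(x) n`. -/
def toBimoduleHom : (ModuleCat.restrictScalars B.subtype).obj
    ((induction B).obj (ModuleCat.of B N)) ⟶
      ModuleCat.of B (BimoduleHom B (RightDual.CounitKer B) N) :=
  ModuleCat.ofHom (X := (ModuleCat.restrictScalars B.subtype).obj
    ((induction B).obj (ModuleCat.of B N)))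
    { toFun := fun t => ({ toFun := fun w => dualEval (w : RightDual B) (show BTensor Λ B Λ N from t)
                           map_add' := fun _ _ => dualEval_add _ _ _
                           map_smul' := fun _ _ => dualEval_smul _ _ _ } :
                             RightDual.CounitKer B →ₗ[B] N)
      map_add' := fun _ _ => BimoduleHom.ext fun _ => map_add (dualEval _) _ _
      map_smul' := fun _ _ => BimoduleHom.ext fun _ => (dualEval_op_smul _ _ _).symm }

variable (B N) in
lemma unit_comp_toBimoduleHom :
    (inductionAdj B).unit.app (ModuleCat.of B N) ≫ toBimoduleHom B N = 0 := by
  ext n w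
  have hw : (w : RightDual B) 1 = 0 := w.2
  change (w : RightDual B) 1 • n = 0
  rw [hw, zero_smul]

/-- The sequence `0 → N → Λ ⊗_B N → Hom_B(W̄, N) → 0` is exact. -/
lemma shortExact_unit_toBimoduleHom {n : ℕ} {e : Fin n → Λ} {f : Fin n → RightDual B}
    (hef : ∀ x, ∑ i, e i * (f i x : Λ) = x) (f₀ : RightDual B) (h₀ : f₀ 1 = 1) :
    (ShortComplex.mk _ _ (unit_comp_toBimoduleHom B N)).ShortExact where
  exact := (ShortComplex.moduleCat_exact_iff _).2 fun t ht =>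
    ⟨dualEval f₀ (show BTensor Λ B Λ N from t), eq_one_tmul_of_dualEval_eq_zero hef f₀ h₀ _ fun w =>
      congrArg (fun ψ => BimoduleHom.toLinear ψ w) ht⟩
  mono_f := (ModuleCat.mono_iff_injective _).2 fun x y hxy => by
    have h : dualEval f₀ (BTensor.tmul Λ B 1 (show N from x)) =
      dualEval f₀ (BTensor.tmul Λ B 1 (show N from y)) := congrArg (dualEval f₀) hxy
    rwa [dualEval_tmul, dualEval_tmul, h₀, one_smul, one_smul] at h
  epi_g := (ModuleCat.epi_iff_surjective _).2 fun φ => by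
    -- Extend `φ` to all of `W` by the projection. Evaluating the witness `∑ e i ⊗ φ' (f i)` at `w`
    -- gives `∑ w (e i) • φ' (f i) = φ' w`, by the expansion of `w` in the `f i`.
    let φ' : RightDual B →ₗ[B] N := BimoduleHom.toLinear φ ∘ₗ counitKerProj f₀ h₀
    refine ⟨(∑ i, BTensor.tmul Λ B (e i) (φ' (f i)) : BTensor Λ B Λ N),
      BimoduleHom.ext fun w => ?_⟩
    refine (map_sum (dualEval (N := N) (w : RightDual B)) _ _).trans ?_
    have h : φ' w = BimoduleHom.toLinear φ w := congrArg _ (counitKerProj_coe f₀ h₀ w)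
    rw [← h]
    conv_rhs => rw [← sum_smul_dual_basis hef (w : RightDual B), map_sum]
    exact Finset.sum_congr rfl fun i _ => (map_smul φ' _ _).symm

end Extension

end RingExt

end

theorem mainTheorem3 {Λ : Type u} [Ring Λ] (B : Subring Λ)
    [Module.Finite (B : Type u)ᵐᵒᵖ Λ] [Module.Projective (B : Type u)ᵐᵒᵖ Λ]
    (hgen : IsSeparator (ModuleCat.of.{u} (B : Type u)ᵐᵒᵖ Λ))
    (hsurj : ∀ (M N : ModuleCat.{u} B) (i : ℕ), 1 ≤ i →
      Function.Surjective (RingExt.inducedExt B M N i))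
    (hbij : ∀ (M N : ModuleCat.{u} B) (i : ℕ), 2 ≤ i →
      Function.Bijective (RingExt.inducedExt B M N i)) :
    RingExt.LeftProjectivising B (RingExt.RightDual.CounitKer B) := by
  obtain ⟨n, e, f, hef⟩ := RingExt.exists_dual_basis B
  obtain ⟨f₀, h₀⟩ := RingExt.exists_apply_one_eq_one B hgen
  have := RingExt.projective_counitKer hef f₀ h₀
  exact RingExt.leftProjectivising_of_injective fun N _ _ =>
    RingExt.injective_of_shortExact_unit (RingExt.inductionAdj B)
      (fun M => hsurj M (ModuleCat.of B N) 1 le_rfl)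
      (fun M => (hbij M (ModuleCat.of B N) 2 le_rfl).1) _ _
      (RingExt.shortExact_unit_toBimoduleHom hef f₀ h₀)
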